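/- Let $a=(a_k)_{k\in\mathbb Z}$ be complex numbers and let $L$ be a bounded operator on $\ell^2(\mathbb Z)$ represented by the biinfinite Toeplitz matrix $L_{kl}=a_{k-l}$, $k,l\in\mathbb Z$. Assume that $L$ is hermitian positive definite, i.e. self-adjoint with $\langle Lv,v\rangle\ge m\|v\|^2$ for all $v\in\ell^2(\mathbb Z)$ and some $m>0$. For $n\ge 1$ let $L_n=(a_{k-l})_{k,l=-n+1}^{n-1}$ be its finite sections. Then $L$ and all $L_n$ are invertible. Write $\|\cdot\|$ for the $\ell^2$-norm and the induced operator norm, and $\operatorname{cond}(L)=\|L\|\,\|L^{-1}\|$. For $y\in\ell^2(\mathbb Z)$ let $x\in\ell^2(\mathbb Z)$ be the solution of $Lx=y$, let $P_ny=(y_{-n+1},\dots,y_{n-1})$, and let $x^{(n)}=L_n^{-1}P_ny$, extended by zero to an element of $\ell^2(\mathbb Z)$. Then the following hold. (a) There is a function $C_1(\cdot,\cdot)$ of two real variables such that for all $\gamma>0$ and all real $\kappa, R$ there is $\gamma_1$ with $0<\gamma_1<\gamma$ (depending only on $\gamma,\kappa,R$) such that, for all $L$ and $y$ as above with $\operatorname{cond}(L)\le\kappa$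 that satisfy $$|a_k|\le c\,e^{-\gamma|k|},\qquad |y_k|\le c'\,e^{-\gamma|k|}\qquad(k\in\mathbb Z)$$ for some constants $c\le R\|L\|$ and $c'$, $$\|x-x^{(n)}\|\le C_1(\gamma_1,\kappa)\,\|L^{-1}\|\,c'\,e^{-\gamma_1 n}\qquad\text{for all } n\ge 1 .$$ (b) For all $s>1$ and all real $\kappa,R$ there is a constant $c_1$ (depending only on $s,\kappa,R$) such that, for all $L$ and $y$ as above with $\operatorname{cond}(L)\le\kappa$ that satisfy $$|a_k|\le c\,(1+|k|)^{-s},\qquad |y_k|\le c'\,(1+|k|)^{-s}\qquad(k\in\mathbb Z)$$ for some constants $c\le R\|L\|$ and $c'$, $$\|x-x^{(n)}\|\le c_1\,\|L^{-1}\|\,c'\,n^{(1-2s)/2}\qquad\text{for all } n\ge 1 .$$ -/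

import Mathlib

open scoped lp ENNReal

noncomputable section

/-- The complex Hilbert space of square-summable biinfinite sequences. -/
abbrev SeqSpace : Type := ℓ²(ℤ, ℂ)

/-- The bounded operator `L` on `ℓ²(ℤ)` is represented, in the standard orthonormal basis
`e_l = lp.single 2 l 1`, by the biinfinite Toeplitz matrix with entries `L_{kl} = a_{k-l}`. -/
def IsToeplitz (L : SeqSpace →L[ℂ] SeqSpace) (a : ℤ → ℂ) : Prop :=
  ∀ k l : ℤ, (L (lp.single 2 l (1 : ℂ)) : ℤ → ℂ) k = a (k - l)

/-- Hermitian positive definite operators: self-adjoint with a strictly positive lower bound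
(for a Toeplitz operator with continuous symbol `f` this says `f > 0` everywhere). -/
structure IsHPD (L : SeqSpace →L[ℂ] SeqSpace) : Prop where
  selfAdjoint : IsSelfAdjoint L
  lowerBound : ∃ m : ℝ, 0 < m ∧ ∀ x : SeqSpace, m * ‖x‖ ^ 2 ≤ (inner ℂ (L x) x).re

/-- The inverse of an operator (with value `0` if the operator is not invertible). -/
def opInv (L : SeqSpace →L[ℂ] SeqSpace) : SeqSpace →L[ℂ] SeqSpace := Ring.inverse L

/-- The condition number with respect to the operator norm. -/
def condNumber (L : SeqSpace →L[ℂ] SeqSpace) : ℝ := ‖L‖ * ‖opInv L‖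

/-- The index set `{-n+1, …, n-1}` of the `n`-th finite section. -/
abbrev SectionIndex (n : ℕ) : Type := ↥(Finset.Icc (-(n : ℤ) + 1) ((n : ℤ) - 1))

/-- The finite section `L_n`: the `(2n-1) × (2n-1)` matrix with entries `a_{k-l}`. -/
def finiteSection (a : ℤ → ℂ) (n : ℕ) : Matrix (SectionIndex n) (SectionIndex n) ℂ :=
  Matrix.of fun k l => a ((k : ℤ) - (l : ℤ))

/-- The truncated right-hand side `P_n y`, as a vector indexed by `{-n+1, …, n-1}`. -/
def truncation (y : SeqSpace) (n : ℕ) : SectionIndex n → ℂ := fun k => y (k : ℤ)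

/-- The finite-section approximation `x^{(n)} = L_n⁻¹ P_n y`, extended by zero to an element
of `ℓ²(ℤ)`. -/
def sectionSolution (a : ℤ → ℂ) (y : SeqSpace) (n : ℕ) : SeqSpace :=
  ∑ k : SectionIndex n,
    lp.single 2 (k : ℤ) (((finiteSection a n)⁻¹.mulVec (truncation y n)) k)

end

/-!
The error of the finite section method is controlled by the part of the solution `x` outside the
section: since `L` is positive definite with lower bound `1 / ‖L⁻¹‖`, Galerkin orthogonality gives
`‖x - x⁽ⁿ⁾‖ ≤ (1 + cond L) ‖x - Pₙ x‖` (`IsHPD.norm_sub_sectionSolution_le`). It remains to show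
that `x` inherits the decay of `a` and `y`, with constants that depend on `κ`, `R` and the rate
only, i.e. a quantitative form of Wiener's lemma.

With `μ = 1 / (‖L⁻¹‖ ‖L‖²)` the equation `L x = y` becomes `x = μ y + B x`, where `B = 1 - μ L` has
norm at most `q = √(1 - κ⁻²) < 1` and a symbol `B e₀` dominated by `1 + max R 0` times the weight
(`IsHPD.exists_contraction`). Such a `B` need not be a contraction for the `ℓ¹` norm of symbols,
but a power of it is, uniformly (`exists_pow_weightedSum_le`): write `B = near + far` with `near`
banded of bandwidth `N` and `far` of `ℓ¹` norm at most `ε`. The symbol of `near ^ m` is supported in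
`[-mN, mN]`, so its `ℓ¹` norm is at most `(2mN + 1) ‖near‖ᵐ ≤ (2mN + 1) (q + ε)ᵐ`. As the two parts
commute, the binomial theorem bounds the `ℓ¹` norm of the symbol of `B ^ J` by
`(2JN + 1) (q + 2ε)ᴶ`, which tends to `0`.

Now `x` is the fixed point of `v ↦ z + B ^ J v` with `z = ∑_{i < J} Bⁱ (μ y)`, and it lies in every
closed set that contains `0` and is mapped to itself (`mem_of_eq_add_apply`). For polynomial weights
`ω` the set is given by bounds for `∑ |v k|` and for `sup |v k| / ω k`; in the latter, the bound for
`v` is multiplied by the `ℓ¹` norm of the symbol of `B ^ J` only (`exists_dominated_bound`). For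
exponential weights the set is given by a bound for `∑ |v k| exp (η |k|)`; the corresponding norm
of the symbol of `B ^ J` is close to its `ℓ¹` norm for small `η`, by convexity of the exponential
function (`exists_weightedSum_bound`).

All `ℓ¹` norms take values in `[0, ∞]`, so that no summability has to be assumed.
-/

open Filter Topology

/-! ### Translations and translation-invariant operators -/

/-- The bilateral shift by `j` on `ℓ²(ℤ)`: `(shift j x)_k = x_{k-j}`. -/
noncomputable def shift (j : ℤ) : SeqSpace →L[ℂ] SeqSpace :=
  LinearMap.mkContinuous
    { toFun := fun x => ⟨fun k => x (k - j), by
        refine memℓp_gen ?_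
        have h := (lp.memℓp x).summable (by norm_num)
        exact h.comp_injective (i := fun k : ℤ => k - j) (sub_left_injective)⟩
      map_add' := fun x y => by ext k; rfl
      map_smul' := fun c x => by ext k; rfl } 1 (fun x => by
    rw [one_mul]
    refine lp.norm_le_of_tsum_le (p := 2) (by norm_num) (norm_nonneg _) ?_
    rw [lp.norm_rpow_eq_tsum (by norm_num)]
    exact ((Equiv.subRight j).tsum_eq (fun k : ℤ => ‖x k‖ ^ (2 : ℝ≥0∞).toReal)).le)

@[simp] theorem shift_apply (j : ℤ) (x : SeqSpace) (k : ℤ) : shift j x k = x (k - j) := rfl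

theorem norm_shift_le (j : ℤ) : ‖shift j‖ ≤ 1 := LinearMap.mkContinuous_norm_le _ zero_le_one _

/-- The standard unit vector `e_0`. The symbol of an operator `T` is the sequence `T e_0`. -/
noncomputable abbrev unitVec : SeqSpace := lp.single 2 0 (1 : ℂ)

theorem norm_unitVec : ‖unitVec‖ = 1 := by
  rw [lp.norm_single (by norm_num), norm_one]

instance nontrivial_seqSpace : Nontrivial SeqSpace :=
  ⟨unitVec, 0, fun h => by simpa [h] using norm_unitVec⟩

theorem shift_unitVec (l : ℤ) : shift l unitVec = lp.single 2 l (1 : ℂ) := by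
  ext k
  simp [lp.single_apply, Pi.single_apply, sub_eq_zero]

/-- Operators commuting with all translations, i.e. the bounded operators with a Toeplitz matrix. -/
def TranslationInvariant (T : SeqSpace →L[ℂ] SeqSpace) : Prop := ∀ j, Commute (shift j) T

theorem ext_single {S T : SeqSpace →L[ℂ] SeqSpace}
    (h : ∀ l : ℤ, S (lp.single 2 l (1 : ℂ)) = T (lp.single 2 l 1)) : S = T := by
  refine lp.ext_continuousLinearMap (by norm_num) fun i => ?_
  ext1
  simpa using h i

theorem IsToeplitz.apply_unitVec {L : SeqSpace →L[ℂ] SeqSpace} {a : ℤ → ℂ}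
    (h : IsToeplitz L a) (k : ℤ) : L unitVec k = a k := by
  simpa using h k 0

theorem IsToeplitz.translationInvariant {L : SeqSpace →L[ℂ] SeqSpace} {a : ℤ → ℂ}
    (h : IsToeplitz L a) : TranslationInvariant L := by
  intro j
  refine ext_single fun l => ?_
  ext k
  have : shift j (lp.single 2 l (1 : ℂ)) = lp.single 2 (l + j) 1 := by
    ext k
    simp [lp.single_apply, Pi.single_apply, sub_eq_iff_eq_add]
  simp only [mul_apply_eq_comp, shift_apply, this]
  rw [h, h]
  congr 1
  ring

namespace TranslationInvariant

variable {S T : SeqSpace →L[ℂ] SeqSpace}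

theorem pow (hT : TranslationInvariant T) (n : ℕ) : TranslationInvariant (T ^ n) :=
  fun j => (hT j).pow_right n

theorem sub (hS : TranslationInvariant S) (hT : TranslationInvariant T) :
    TranslationInvariant (S - T) := fun j => (hS j).sub_right (hT j)

theorem one : TranslationInvariant 1 := fun _ => Commute.one_right _

theorem smul (c : ℂ) (hT : TranslationInvariant T) : TranslationInvariant (c • T) :=
  fun j => (hT j).smul_right c

theorem shift (i : ℤ) : TranslationInvariant (shift i) := fun j => by
  refine ext_single fun l => ?_
  ext k
  simp only [mul_apply_eq_comp, shift_apply]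
  rw [sub_right_comm]

theorem apply_single (hT : TranslationInvariant T) (k l : ℤ) :
    T (lp.single 2 l (1 : ℂ)) k = T unitVec (k - l) := by
  rw [← shift_unitVec, ← mul_apply_eq_comp, ← hT l]
  rfl

/-- A translation-invariant operator acts by convolution with its symbol. -/
theorem hasSum_apply (hT : TranslationInvariant T) (x : SeqSpace) (k : ℤ) :
    HasSum (fun l => x l * T unitVec (k - l)) (T x k) := by
  have h := (lp.hasSum_single (p := 2) (by norm_num) x).mapL T
  have h2 := h.mapL (lp.evalCLM ℂ (fun _ : ℤ => ℂ) 2 k)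
  have h3 : ∀ l : ℤ, lp.evalCLM ℂ (fun _ : ℤ => ℂ) 2 k (T (lp.single 2 l (x l)))
      = x l * T unitVec (k - l) := fun l => by
    have : lp.single (E := fun _ : ℤ => ℂ) 2 l (x l) = x l • lp.single 2 l (1 : ℂ) := by
      rw [← lp.single_smul]; simp
    rw [this, map_smul, map_smul, ← hT.apply_single]
    rfl
  simp only [h3] at h2
  exact h2

theorem enorm_apply_le (hT : TranslationInvariant T) (x : SeqSpace) (k : ℤ) :
    ‖T x k‖ₑ ≤ ∑' l, ‖T unitVec (k - l)‖ₑ * ‖x l‖ₑ := by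
  rw [← (hT.hasSum_apply x k).tsum_eq]
  refine enorm_tsum_le_tsum_enorm.trans (ENNReal.tsum_le_tsum fun l => ?_)
  rw [enorm_mul, mul_comm]

/-- An operator with summable symbol is the norm-convergent series `∑ t_k S^k` of shifts. -/
theorem hasSum_shift (hT : TranslationInvariant T) (hs : Summable fun k => ‖T unitVec k‖) :
    HasSum (fun k => T unitVec k • _root_.shift k) T := by
  have hsum : Summable (fun k => T unitVec k • _root_.shift k) := by
    refine Summable.of_norm_bounded hs fun k => ?_
    rw [norm_smul]
    exact mul_le_of_le_one_right (norm_nonneg _) (norm_shift_le k)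
  convert! hsum.hasSum using 1
  refine ext_single fun l => ?_
  have h := (hsum.hasSum.mapL (ContinuousLinearMap.apply ℂ SeqSpace (lp.single 2 l (1 : ℂ))))
  ext k
  have h2 := h.mapL (lp.evalCLM ℂ (fun _ : ℤ => ℂ) 2 k)
  have h3 := h2.unique (hasSum_single (k - l) fun j hj => ?_)
  · refine Eq.trans ?_ h3.symm
    change _ = T unitVec (k - l) • (lp.single 2 l (1 : ℂ) : SeqSpace) (k - (k - l))
    rw [hT.apply_single]
    simp
  · change T unitVec j • (lp.single 2 l (1 : ℂ) : SeqSpace) (k - j) = 0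
    rw [lp.single_apply_ne _ _ _ (by omega), smul_zero]

end TranslationInvariant

/-! ### Weighted `ℓ¹` norms -/

/-- The weighted `ℓ¹` norm `∑_k |v_k| w_k`, with values in `[0, ∞]`. -/
noncomputable def weightedSum (w : ℤ → ℝ≥0∞) (v : ℤ → ℂ) : ℝ≥0∞ := ∑' k, ‖v k‖ₑ * w k

theorem weightedSum_add_le (w : ℤ → ℝ≥0∞) (u v : SeqSpace) :
    weightedSum w (u + v : SeqSpace) ≤ weightedSum w u + weightedSum w v := by
  unfold weightedSum
  rw [← ENNReal.tsum_add]
  refine ENNReal.tsum_le_tsum fun k => ?_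
  rw [← add_mul]
  gcongr
  exact enorm_add_le _ _

theorem weightedSum_zero (w : ℤ → ℝ≥0∞) : weightedSum w (0 : SeqSpace) = 0 := by
  simp [weightedSum]

theorem weightedSum_smul (w : ℤ → ℝ≥0∞) (c : ℂ) (v : SeqSpace) :
    weightedSum w (c • v : SeqSpace) = ‖c‖ₑ * weightedSum w v := by
  unfold weightedSum
  rw [← ENNReal.tsum_mul_left]
  refine tsum_congr fun k => ?_
  rw [lp.coeFn_smul, Pi.smul_apply, smul_eq_mul, enorm_mul, mul_assoc]

theorem weightedSum_sum_le (w : ℤ → ℝ≥0∞) {ι : Type*} (s : Finset ι) (v : ι → SeqSpace) :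
    weightedSum w (∑ i ∈ s, v i : SeqSpace) ≤ ∑ i ∈ s, weightedSum w (v i) := by
  classical
  induction s using Finset.induction_on with
  | empty => simp [weightedSum]
  | insert i s hi ih =>
    rw [Finset.sum_insert hi, Finset.sum_insert hi]
    exact (weightedSum_add_le _ _ _).trans (by gcongr)

theorem weightedSum_unitVec (w : ℤ → ℝ≥0∞) : weightedSum w unitVec = w 0 := by
  unfold weightedSum
  rw [tsum_eq_single 0 fun k hk => by rw [lp.single_apply_ne _ _ _ hk]; simp]
  simp

/-- Young's inequality for a submultiplicative weight. -/
theorem TranslationInvariant.weightedSum_apply_le {T : SeqSpace →L[ℂ] SeqSpace}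
    (hT : TranslationInvariant T) {w : ℤ → ℝ≥0∞} (hw : ∀ k l, w (k + l) ≤ w k * w l)
    (x : SeqSpace) :
    weightedSum w (T x) ≤ weightedSum w (T unitVec) * weightedSum w x := by
  calc weightedSum w (T x) ≤ ∑' k, ∑' l, (‖T unitVec (k - l)‖ₑ * w (k - l)) * (‖x l‖ₑ * w l) := by
        refine ENNReal.tsum_le_tsum fun k => ?_
        calc _ ≤ (∑' l, ‖T unitVec (k - l)‖ₑ * ‖x l‖ₑ) * w k := by
              gcongr; exact hT.enorm_apply_le x k
          _ = ∑' l, ‖T unitVec (k - l)‖ₑ * ‖x l‖ₑ * w k := ENNReal.tsum_mul_right.symm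
          _ ≤ _ := by
            refine ENNReal.tsum_le_tsum fun l => ?_
            have := hw (k - l) l
            rw [sub_add_cancel] at this
            calc _ ≤ ‖T unitVec (k - l)‖ₑ * ‖x l‖ₑ * (w (k - l) * w l) := by gcongr
              _ = _ := by ring
    _ = ∑' l, ∑' k, (‖T unitVec (k - l)‖ₑ * w (k - l)) * (‖x l‖ₑ * w l) := ENNReal.tsum_comm
    _ = ∑' l, weightedSum w (T unitVec) * (‖x l‖ₑ * w l) := by
        refine tsum_congr fun l => ?_
        rw [ENNReal.tsum_mul_right]
        congr 1
        exact (Equiv.subRight l).tsum_eq (fun k : ℤ => ‖T unitVec k‖ₑ * w k)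
    _ = _ := ENNReal.tsum_mul_left

theorem TranslationInvariant.weightedSum_pow_apply_le {T : SeqSpace →L[ℂ] SeqSpace}
    (hT : TranslationInvariant T) {w : ℤ → ℝ≥0∞} (hw : ∀ k l, w (k + l) ≤ w k * w l)
    (n : ℕ) (x : SeqSpace) :
    weightedSum w ((T ^ n) x) ≤ weightedSum w (T unitVec) ^ n * weightedSum w x := by
  induction n with
  | zero => simp
  | succ n ih =>
    rw [pow_succ', mul_apply_eq_comp, pow_succ', mul_assoc]
    exact (hT.weightedSum_apply_le hw _).trans (by gcongr)

theorem enorm_apply_le_enorm (x : SeqSpace) (k : ℤ) : ‖x k‖ₑ ≤ ‖x‖ₑ :=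
  enorm_le_iff_norm_le.2 (lp.norm_apply_le_norm (by norm_num) x k)

/-- On sequences supported in `[-N, N]` the `ℓ¹` norm is at most `2N+1` times the `ℓ²` norm. -/
theorem weightedSum_one_le_of_support {x : SeqSpace} {N : ℕ}
    (h : ∀ k : ℤ, (N : ℤ) < |k| → x k = 0) :
    weightedSum 1 x ≤ (2 * N + 1 : ℕ) * ‖x‖ₑ := by
  unfold weightedSum
  rw [tsum_eq_sum (s := Finset.Icc (-(N : ℤ)) N) fun k hk => by
    rw [h k (by simp only [Finset.mem_Icc, not_and_or, not_le] at hk; rw [lt_abs]; omega)]; simp]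
  refine (Finset.sum_le_sum fun k _ => ?_).trans_eq
    ((Finset.sum_const (‖x‖ₑ)).trans ?_)
  · simpa using enorm_apply_le_enorm x k
  · rw [nsmul_eq_mul, Int.card_Icc]
    congr 2
    omega

/-! ### Powers of contractions with dominated symbols -/

/-- A finite combination of the shifts by `k ∈ F` moves supports by at most `N ≥ max |k|`. -/
theorem pow_sum_shift_support {F : Finset ℤ} {N : ℕ} (hF : ∀ k ∈ F, |k| ≤ (N : ℤ)) (b : ℤ → ℂ)
    (m : ℕ) (k : ℤ) (hk : ((m * N : ℕ) : ℤ) < |k|) :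
    ((∑ j ∈ F, b j • shift j) ^ m) unitVec k = 0 := by
  induction m generalizing k with
  | zero =>
    have : k ≠ 0 := by rintro rfl; simp at hk
    simpa using lp.single_apply_ne (E := fun _ : ℤ => ℂ) 2 0 1 this
  | succ m ih =>
    rw [pow_succ', mul_apply_eq_comp]
    simp only [sum_apply, lp.coeFn_sum, Finset.sum_apply]
    refine Finset.sum_eq_zero fun j hj => ?_
    change b j • (((∑ j ∈ F, b j • shift j) ^ m) unitVec) (k - j) = 0
    rw [ih, smul_zero]
    have h1 := hF j hj
    have h2 := abs_sub_abs_le_abs_sub k j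
    push_cast at hk ⊢
    linarith

theorem sum_shift_unitVec_apply (F : Finset ℤ) (b : ℤ → ℂ) (k : ℤ) :
    (∑ j ∈ F, b j • shift j) unitVec k = if k ∈ F then b k else 0 := by
  simp only [sum_apply, lp.coeFn_sum, Finset.sum_apply]
  rw [← Finset.sum_ite_eq F k b]
  refine Finset.sum_congr rfl fun j _ => ?_
  change b j • (unitVec (k - j)) = _
  simp [lp.single_apply, Pi.single_apply, sub_eq_zero]

/-- Uniform version of the spectral radius formula behind Wiener's lemma: if the symbols of a
family of translation-invariant operators of norm at most `q < 1` are dominated by one summable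
sequence `g`, then the `ℓ¹` norms of the symbols of their powers become small uniformly. The
operator is split into a banded part, for whose powers the `ℓ¹` norm exceeds the operator norm by
a factor linear in the exponent only, and a part of small `ℓ¹` norm. -/
theorem exists_pow_weightedSum_le {g : ℤ → ℝ≥0∞} (hg : ∑' k, g k ≠ ⊤) {q : ℝ} (hq0 : 0 ≤ q)
    (hq : q < 1) {δ : ℝ≥0∞} (hδ : 0 < δ) :
    ∃ J : ℕ, 1 ≤ J ∧ ∀ B : SeqSpace →L[ℂ] SeqSpace, TranslationInvariant B → ‖B‖ ≤ q →
      (∀ k, ‖B unitVec k‖ₑ ≤ g k) → weightedSum 1 ((B ^ J) unitVec) ≤ δ := by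
  -- the margin `ε` is such that `q + 2 ε < 1`
  set ε : ℝ := (1 - q) / 4 with hε
  have hε0 : 0 < ε := by rw [hε]; linarith
  obtain ⟨F, hFtail⟩ : ∃ F : Finset ℤ, ∑' k : {k // k ∉ F}, g k ≤ ENNReal.ofReal ε :=
    ((ENNReal.tendsto_tsum_compl_atTop_zero hg).eventually_le_const
      (ENNReal.ofReal_pos.2 hε0)).exists
  obtain ⟨N, hN⟩ : ∃ N : ℕ, ∀ k ∈ F, |k| ≤ (N : ℤ) := by
    refine ⟨F.sup Int.natAbs, fun k hk => ?_⟩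
    rw [Int.abs_eq_natAbs]
    exact_mod_cast Finset.le_sup (f := Int.natAbs) hk
  set r : ℝ := q + 2 * ε with hr
  have hr0 : 0 ≤ r := by positivity
  have hr1 : r < 1 := by rw [hr, hε]; linarith
  have hlim : Tendsto (fun J : ℕ => ENNReal.ofReal ((2 * (J * N) + 1) * r ^ J)) atTop (𝓝 0) := by
    have h1 := tendsto_self_mul_const_pow_of_lt_one hr0 hr1
    have h2 := tendsto_pow_atTop_nhds_zero_of_lt_one hr0 hr1
    have h3 := (h1.const_mul (2 * (N : ℝ))).add h2
    rw [mul_zero, add_zero] at h3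
    rw [← ENNReal.ofReal_zero]
    refine (ENNReal.tendsto_ofReal h3).congr fun J => ?_
    congr 1
    ring
  obtain ⟨J, hJ, hJ1⟩ := ((hlim.eventually_le_const hδ).and (eventually_ge_atTop 1)).exists
  refine ⟨J, hJ1, fun B hB hBq hBg => le_trans ?_ hJ⟩
  set b : ℤ → ℂ := fun k => B unitVec k with hb
  have hsum : Summable fun k => ‖b k‖ :=
    tsum_enorm_ne_top_iff_summable_norm.1 (ne_top_of_le_ne_top hg (ENNReal.tsum_le_tsum hBg))
  set near : SeqSpace →L[ℂ] SeqSpace := ∑ j ∈ F, b j • shift j with hnear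
  set far := B - near with hfar
  have hnearTI : TranslationInvariant near := fun j =>
    Commute.sum_right _ _ _ fun i _ => (TranslationInvariant.shift i).smul (b i) j
  have hfarTI : TranslationInvariant far := hB.sub hnearTI
  have htail : ENNReal.ofReal (∑' k : {k // k ∉ F}, ‖b k‖) ≤ ENNReal.ofReal ε := by
    rw [ENNReal.ofReal_tsum_of_nonneg (fun _ => norm_nonneg _) (hsum.subtype _)]
    refine le_trans (ENNReal.tsum_le_tsum fun k => ?_) hFtail
    rw [ofReal_norm]
    exact hBg k
  have hfar_norm : ‖far‖ ≤ ε := by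
    have h1 : HasSum (fun k : {k // k ∉ F} => b k • shift k) far := by
      have h := hB.hasSum_shift hsum
      rw [hfar, hnear]
      refine (F.hasSum_compl_iff (f := fun k => b k • shift k)).2 ?_
      rw [sub_add_cancel]
      exact h
    rw [← h1.tsum_eq]
    have h2 : Summable fun k : {k // k ∉ F} => ‖b k‖ := hsum.subtype _
    refine (tsum_of_norm_bounded h2.hasSum fun k => ?_).trans
      ((ENNReal.ofReal_le_ofReal_iff hε0.le).1 htail)
    rw [norm_smul]
    exact mul_le_of_le_one_right (norm_nonneg _) (norm_shift_le _)
  have hfar_l1 : weightedSum 1 (far unitVec) ≤ ENNReal.ofReal ε := by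
    refine le_trans ?_ htail
    rw [ENNReal.ofReal_tsum_of_nonneg (fun _ => norm_nonneg _) (hsum.subtype _)]
    have h1 : ∀ k, far unitVec k = if k ∈ F then 0 else b k := fun k => by
      have : far unitVec k = b k - near unitVec k := rfl
      rw [this, hnear, sum_shift_unitVec_apply]
      split_ifs <;> simp
    unfold weightedSum
    have h2 : Function.support (fun k => ‖far unitVec k‖ₑ * (1 : ℤ → ℝ≥0∞) k)
        ⊆ {k | k ∉ F} := fun k hk hkF => hk (by simp [h1, hkF])
    rw [← tsum_subtype_eq_of_support_subset h2]
    refine ENNReal.tsum_le_tsum fun k => ?_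
    rw [h1, if_neg k.2, Pi.one_apply, mul_one, ofReal_norm]
  have hnear_norm : ‖near‖ ≤ q + ε := by
    have : near = B - far := by rw [hfar]; abel
    rw [this]
    exact (norm_sub_le _ _).trans (add_le_add hBq hfar_norm)
  have hnear_l1 : ∀ m ≤ J, weightedSum 1 ((near ^ m) unitVec)
      ≤ ENNReal.ofReal ((2 * (J * N) + 1) * (q + ε) ^ m) := fun m hm => by
    refine (weightedSum_one_le_of_support (N := m * N)
      (pow_sum_shift_support hN b m)).trans ?_
    rw [ENNReal.ofReal_mul (by positivity)]
    refine mul_le_mul' ?_ ?_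
    · rw [← ENNReal.ofReal_natCast]
      refine ENNReal.ofReal_le_ofReal ?_
      push_cast
      gcongr
    · rw [← ofReal_norm]
      refine ENNReal.ofReal_le_ofReal ?_
      have h1 : ‖near ^ m‖ ≤ (q + ε) ^ m :=
        (norm_pow_le _ _).trans (pow_le_pow_left₀ (norm_nonneg _) hnear_norm m)
      calc _ ≤ ‖near ^ m‖ * ‖unitVec‖ := ContinuousLinearMap.le_opNorm _ _
        _ ≤ _ := by rw [lp.norm_single (by norm_num)]; simpa using h1
  have hcomm : Commute near far := by
    refine Commute.sum_left _ _ _ fun j _ => ?_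
    exact (hfarTI j).smul_left _
  have hone : ∀ k l : ℤ, (1 : ℤ → ℝ≥0∞) (k + l) ≤ (1 : ℤ → ℝ≥0∞) k * (1 : ℤ → ℝ≥0∞) l := by simp
  have hB' : B = near + far := by rw [hfar]; abel
  rw [hB', hcomm.add_pow, sum_apply]
  refine (weightedSum_sum_le _ _ _).trans ?_
  have hterm : ∀ m ∈ Finset.range (J + 1),
      weightedSum 1 ((near ^ m * far ^ (J - m) * (J.choose m : SeqSpace →L[ℂ] SeqSpace)) unitVec)
        ≤ ENNReal.ofReal ((2 * (J * N) + 1) * ((q + ε) ^ m * ε ^ (J - m) * J.choose m)) := by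
    intro m hm
    have hm : m ≤ J := Nat.lt_succ_iff.1 (Finset.mem_range.1 hm)
    have h0 : (near ^ m * far ^ (J - m) * (J.choose m : SeqSpace →L[ℂ] SeqSpace)) unitVec
        = (J.choose m : ℂ) • (near ^ m) ((far ^ (J - m)) unitVec) := by
      rw [← (Nat.cast_commute (J.choose m) _).eq, ← nsmul_eq_mul, ← Nat.cast_smul_eq_nsmul ℂ]
      rfl
    rw [h0, weightedSum_smul]
    calc _ ≤ ENNReal.ofReal (J.choose m) * (ENNReal.ofReal ((2 * (J * N) + 1) * (q + ε) ^ m)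
          * ENNReal.ofReal (ε ^ (J - m))) := by
          gcongr
          · rw [← ofReal_norm]; simp
          · refine ((hnearTI.pow m).weightedSum_apply_le hone _).trans ?_
            gcongr
            · exact hnear_l1 m hm
            · refine (hfarTI.weightedSum_pow_apply_le hone _ _).trans ?_
              rw [weightedSum_unitVec, Pi.one_apply, mul_one, ENNReal.ofReal_pow hε0.le]
              gcongr
      _ = _ := by
          rw [← ENNReal.ofReal_mul (by positivity), ← ENNReal.ofReal_mul (by positivity)]
          congr 1
          ring
  refine (Finset.sum_le_sum hterm).trans_eq ?_
  rw [← ENNReal.ofReal_sum_of_nonneg fun _ _ => by positivity, ← Finset.mul_sum, ← add_pow]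
  congr 3
  rw [hr]; ring

/-! ### Fixed points of affine contractions -/

/-- A closed set that contains `0` and is mapped to itself by `v ↦ z + C v`, `‖C‖ < 1`, contains
the fixed point of this map. -/
theorem mem_of_eq_add_apply {C : SeqSpace →L[ℂ] SeqSpace} (hC : ‖C‖ < 1) {x z : SeqSpace}
    (hx : x = z + C x) {K : Set SeqSpace} (hK : IsClosed K) (h0 : (0 : SeqSpace) ∈ K)
    (hmaps : ∀ v ∈ K, z + C v ∈ K) : x ∈ K := by
  have hcon : ContractingWith ‖C‖₊ (fun v => z + C v) := by
    refine ⟨by exact_mod_cast hC, LipschitzWith.of_dist_le_mul fun u v => ?_⟩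
    rw [dist_add_left]
    exact C.lipschitz.dist_le_mul u v
  have hfix : x = ContractingWith.fixedPoint _ hcon := hcon.fixedPoint_unique hx.symm
  rw [hfix]
  refine hK.mem_of_tendsto (hcon.tendsto_iterate_fixedPoint 0) (Eventually.of_forall fun n => ?_)
  induction n with
  | zero => exact h0
  | succ n ih => rw [Function.iterate_succ_apply']; exact hmaps _ ih

/-- Unfolding `x = z + B x` to a power of `B`. -/
theorem eq_sum_add_pow_apply {B : SeqSpace →L[ℂ] SeqSpace} {x z : SeqSpace} (hx : x = z + B x)
    (J : ℕ) : x = ∑ i ∈ Finset.range J, (B ^ i) z + (B ^ J) x := by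
  induction J with
  | zero => simp
  | succ J ih =>
    rw [Finset.sum_range_succ, add_assoc, pow_succ, mul_apply_eq_comp, ← map_add, ← hx]
    exact ih

theorem continuous_apply_seq (k : ℤ) : Continuous fun v : SeqSpace => v k :=
  (lp.evalCLM ℂ (fun _ : ℤ => ℂ) 2 k).continuous

theorem isClosed_setOf_weightedSum_le (w : ℤ → ℝ≥0∞) (hw : ∀ k, w k ≠ ⊤) (D : ℝ≥0∞) :
    IsClosed {v : SeqSpace | weightedSum w v ≤ D} := by
  have : {v : SeqSpace | weightedSum w v ≤ D}
      = ⋂ F : Finset ℤ, {v : SeqSpace | ∑ k ∈ F, ‖v k‖ₑ * w k ≤ D} := by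
    ext v
    simp only [weightedSum, Set.mem_ofPred_eq, Set.mem_iInter, ENNReal.tsum_eq_iSup_sum,
      iSup_le_iff]
  rw [this]
  refine isClosed_iInter fun F => isClosed_le ?_ continuous_const
  exact continuous_finsetSum _ fun k _ =>
    (ENNReal.continuous_mul_const (hw k)).comp (continuous_enorm.comp (continuous_apply_seq k))

theorem isClosed_setOf_enorm_le (u : ℤ → ℝ≥0∞) :
    IsClosed {v : SeqSpace | ∀ k, ‖v k‖ₑ ≤ u k} := by
  simp only [Set.ofPred_forall]
  exact isClosed_iInter fun k =>
    isClosed_le (continuous_enorm.comp (continuous_apply_seq k)) continuous_const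

/-! ### Decay of solutions of `x = μ y + B x` -/

/-- Convolution of two sequences dominated by a weight `ω` for which one of `ω l`, `ω (k - l)` is
always at most `A * ω k`. Each of the two suprema is multiplied by the `ℓ¹` norm of the *other*
factor, which is what makes powers of small `ℓ¹` norm useful. -/
theorem TranslationInvariant.enorm_apply_le_of_dominated {T : SeqSpace →L[ℂ] SeqSpace}
    (hT : TranslationInvariant T) {ω : ℤ → ℝ≥0∞} {A : ℝ≥0∞}
    (hω : ∀ k l, ω l ≤ A * ω k ∨ ω (k - l) ≤ A * ω k) {K D : ℝ≥0∞} {x : SeqSpace}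
    (hTK : ∀ k, ‖T unitVec k‖ₑ ≤ K * ω k) (hxD : ∀ k, ‖x k‖ₑ ≤ D * ω k) (k : ℤ) :
    ‖T x k‖ₑ ≤ A * (D * weightedSum 1 (T unitVec) + K * weightedSum 1 x) * ω k := by
  calc ‖T x k‖ₑ ≤ ∑' l, ‖T unitVec (k - l)‖ₑ * ‖x l‖ₑ := hT.enorm_apply_le x k
    _ ≤ ∑' l, A * ω k * (D * (‖T unitVec (k - l)‖ₑ * 1) + K * (‖x l‖ₑ * 1)) := by
        refine ENNReal.tsum_le_tsum fun l => ?_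
        rw [mul_one, mul_one, mul_add]
        rcases hω k l with h | h
        · refine le_trans ?_ le_self_add
          calc _ ≤ ‖T unitVec (k - l)‖ₑ * (D * (A * ω k)) := by
                gcongr; exact (hxD l).trans (by gcongr)
            _ = _ := by ring
        · refine le_trans ?_ le_add_self
          calc _ ≤ (K * (A * ω k)) * ‖x l‖ₑ := by
                gcongr; exact (hTK _).trans (by gcongr)
            _ = _ := by ring
    _ = A * ω k * (D * weightedSum 1 (T unitVec) + K * weightedSum 1 x) := by
        have h : ∑' l, ‖T unitVec (k - l)‖ₑ * 1 = weightedSum 1 (T unitVec) :=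
          (Equiv.subLeft k).tsum_eq (fun j : ℤ => ‖T unitVec j‖ₑ * 1)
        rw [ENNReal.tsum_mul_left, ENNReal.tsum_add, ENNReal.tsum_mul_left, ENNReal.tsum_mul_left,
          h]
        rfl
    _ = _ := by ring

theorem weightedSum_one_le_of_dominated {ω : ℤ → ℝ≥0∞} {D : ℝ≥0∞} {x : SeqSpace}
    (hxD : ∀ k, ‖x k‖ₑ ≤ D * ω k) : weightedSum 1 x ≤ D * ∑' k, ω k := by
  rw [← ENNReal.tsum_mul_left]
  exact ENNReal.tsum_le_tsum fun k => by simpa using hxD k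

/-- Iterating the algebra property of the sequences dominated by a summable weight. -/
theorem TranslationInvariant.enorm_pow_apply_le_of_dominated {T : SeqSpace →L[ℂ] SeqSpace}
    (hT : TranslationInvariant T) {ω : ℤ → ℝ≥0∞} {A : ℝ≥0∞}
    (hω : ∀ k l, ω l ≤ A * ω k ∨ ω (k - l) ≤ A * ω k) {K D : ℝ≥0∞} {x : SeqSpace}
    (hTK : ∀ k, ‖T unitVec k‖ₑ ≤ K * ω k) (hxD : ∀ k, ‖x k‖ₑ ≤ D * ω k) (i : ℕ) (k : ℤ) :
    ‖(T ^ i) x k‖ₑ ≤ (2 * A * K * ∑' k, ω k) ^ i * D * ω k := by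
  induction i generalizing k with
  | zero => simpa using hxD k
  | succ i ih =>
    rw [pow_succ', mul_apply_eq_comp]
    refine (hT.enorm_apply_le_of_dominated hω hTK ih k).trans (mul_le_mul' ?_ le_rfl)
    calc _ ≤ A * ((2 * A * K * ∑' k, ω k) ^ i * D * (K * ∑' k, ω k)
          + K * ((2 * A * K * ∑' k, ω k) ^ i * D * ∑' k, ω k)) := by
          gcongr
          · exact weightedSum_one_le_of_dominated hTK
          · exact weightedSum_one_le_of_dominated ih
      _ = _ := by ring

theorem norm_pow_lt_one {B : SeqSpace →L[ℂ] SeqSpace} {q : ℝ} (hq : q < 1) (hB : ‖B‖ ≤ q)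
    {J : ℕ} (hJ : 1 ≤ J) : ‖B ^ J‖ < 1 :=
  (norm_pow_le _ _).trans_lt (pow_lt_one₀ (norm_nonneg _) (hB.trans_lt hq) (by omega))

theorem enorm_sum_apply_le {ι : Type*} (s : Finset ι) (v : ι → SeqSpace) (k : ℤ) :
    ‖(∑ i ∈ s, v i : SeqSpace) k‖ₑ ≤ ∑ i ∈ s, ‖v i k‖ₑ := by
  rw [lp.coeFn_sum, Finset.sum_apply]
  exact enorm_sum_le _ _

/-- Uniform decay estimate for weights of polynomial type. -/
theorem exists_dominated_bound {ω : ℤ → ℝ≥0∞} {A : ℝ≥0∞} (hA : A ≠ ⊤) (hω0 : ω 0 = 1)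
    (hω : ∀ k l, ω l ≤ A * ω k ∨ ω (k - l) ≤ A * ω k) (hsum : ∑' k, ω k ≠ ⊤)
    {q : ℝ} (hq0 : 0 ≤ q) (hq : q < 1) {K : ℝ≥0∞} (hK : K ≠ ⊤) :
    ∃ D₀ : ℝ≥0∞, D₀ ≠ ⊤ ∧ ∀ (B : SeqSpace →L[ℂ] SeqSpace) (x z : SeqSpace) (Z : ℝ≥0∞),
      TranslationInvariant B → ‖B‖ ≤ q → (∀ k, ‖B unitVec k‖ₑ ≤ K * ω k) →
      (∀ k, ‖z k‖ₑ ≤ Z * ω k) → x = z + B x → ∀ k, ‖x k‖ₑ ≤ D₀ * Z * ω k := by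
  set S := ∑' k, ω k with hS
  set Q := 2 * A * K * S with hQ
  have hQtop : Q ≠ ⊤ := by
    rw [hQ]; exact ENNReal.mul_ne_top (ENNReal.mul_ne_top (ENNReal.mul_ne_top (by simp) hA) hK) hsum
  -- `ω 0 = 1` forces `1 ≤ A`
  have hA1 : 1 ≤ A := by
    have := hω 0 0
    simpa [hω0] using this
  have hA0 : A ≠ 0 := fun h => by simp [h] at hA1
  -- `δ = 1 / (2 A)` makes the self-referential term of the supremum bound contract by `1 / 2`
  obtain ⟨J, hJ1, hJ⟩ := exists_pow_weightedSum_le (g := fun k => K * ω k)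
    (by rw [ENNReal.tsum_mul_left]; exact ENNReal.mul_ne_top hK hsum) hq0 hq
    (δ := A⁻¹ * 2⁻¹) (ENNReal.mul_pos (ENNReal.inv_ne_zero.2 hA) (by simp))
  set G := ∑ i ∈ Finset.range J, Q ^ i with hG
  -- `E` is the solution of `E = G + E / 2 + A * Q ^ J * (2 * G * S)`
  set E := 2 * G * (1 + 2 * A * Q ^ J * S) with hE
  have hGtop : G ≠ ⊤ := by
    rw [hG]; exact (ENNReal.sum_lt_top.2 fun i _ => (ENNReal.pow_ne_top hQtop).lt_top).ne
  refine ⟨E, ?_, fun B x z Z hB hBq hBK hz hx => ?_⟩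
  · rw [hE]
    refine ENNReal.mul_ne_top (ENNReal.mul_ne_top (by simp) hGtop) (ENNReal.add_ne_top.2
      ⟨by simp, ENNReal.mul_ne_top (ENNReal.mul_ne_top (ENNReal.mul_ne_top (by simp) hA)
        (ENNReal.pow_ne_top hQtop)) hsum⟩)
  set C := B ^ J with hC
  set y := ∑ i ∈ Finset.range J, (B ^ i) z with hy
  have hCl1 : weightedSum 1 (C unitVec) ≤ A⁻¹ * 2⁻¹ := hJ B hB hBq hBK
  have hunit : ∀ k, ‖unitVec k‖ₑ ≤ 1 * ω k := fun k => by
    rcases eq_or_ne k 0 with rfl | hk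
    · simp [hω0]
    · rw [lp.single_apply_ne _ _ _ hk]; simp
  have hCK : ∀ k, ‖C unitVec k‖ₑ ≤ Q ^ J * ω k := fun k => by
    have h := hB.enorm_pow_apply_le_of_dominated hω hBK hunit J k
    rwa [mul_one] at h
  have hyG : ∀ k, ‖y k‖ₑ ≤ G * Z * ω k := fun k => by
    refine (enorm_sum_apply_le _ _ _).trans ?_
    rw [hG, Finset.sum_mul, Finset.sum_mul]
    exact Finset.sum_le_sum fun i _ => hB.enorm_pow_apply_le_of_dominated hω hBK hz i k
  have hy1 : weightedSum 1 y ≤ G * Z * S := weightedSum_one_le_of_dominated hyG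
  refine (mem_of_eq_add_apply (C := C) (norm_pow_lt_one hq hBq hJ1) (z := y)
    (eq_sum_add_pow_apply hx J) ((isClosed_setOf_weightedSum_le 1 (by simp) (2 * (G * Z * S))).inter
      (isClosed_setOf_enorm_le fun k => E * Z * ω k)) ⟨?_, ?_⟩ ?_).2
  · change weightedSum 1 (0 : SeqSpace) ≤ _
    rw [weightedSum_zero]
    exact zero_le
  · intro k
    simp
  · rintro v ⟨hv1, hv2⟩
    change weightedSum 1 v ≤ _ at hv1
    change ∀ k, ‖v k‖ₑ ≤ _ at hv2
    refine ⟨?_, fun k => ?_⟩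
    · change weightedSum 1 (y + C v : SeqSpace) ≤ _
      have hA' : A⁻¹ * 2⁻¹ ≤ 2⁻¹ := mul_le_of_le_one_left' (ENNReal.inv_le_one.2 hA1)
      calc _ ≤ weightedSum 1 y + weightedSum 1 (C v) := weightedSum_add_le _ _ _
        _ ≤ G * Z * S + 2⁻¹ * (2 * (G * Z * S)) := by
            gcongr
            refine ((hB.pow J).weightedSum_apply_le (by simp) v).trans ?_
            gcongr
            exact hCl1.trans hA'
        _ = _ := by
            rw [← mul_assoc, ENNReal.inv_mul_cancel (by simp) (by simp), one_mul, two_mul]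
    · change ‖y k + C v k‖ₑ ≤ _
      calc _ ≤ ‖y k‖ₑ + ‖C v k‖ₑ := enorm_add_le _ _
        _ ≤ G * Z * ω k + A * (E * Z * (A⁻¹ * 2⁻¹) + Q ^ J * (2 * (G * Z * S))) * ω k := by
            gcongr
            · exact hyG k
            · refine ((hB.pow J).enorm_apply_le_of_dominated hω hCK hv2 k).trans ?_
              gcongr
        _ = (G * Z + (A * A⁻¹) * ((2⁻¹ * 2) * (G * Z * (1 + 2 * A * Q ^ J * S)))
              + G * Z * (2 * A * Q ^ J * S)) * ω k := by
            rw [hE]; ring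
        _ = _ := by
            rw [ENNReal.mul_inv_cancel hA0 hA, ENNReal.inv_mul_cancel (by simp) (by simp), hE]
            ring

/-- Uniform decay estimate in the weighted `ℓ¹` norms for a family `w η`, `η ∈ (0, 1]`, of
submultiplicative weights with `w η ≤ 1 + η w₁` (exponential weights with small rate). -/
theorem exists_weightedSum_bound {w : ℝ → ℤ → ℝ≥0∞} {w₁ : ℤ → ℝ≥0∞}
    (hwtop : ∀ η k, w η k ≠ ⊤)
    (hw : ∀ η, 0 < η → ∀ k l, w η (k + l) ≤ w η k * w η l)
    (hw₁ : ∀ k l, w₁ (k + l) ≤ w₁ k * w₁ l) (hw₁0 : w₁ 0 = 1)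
    (hww : ∀ η, 0 < η → η ≤ 1 → ∀ k, w η k ≤ 1 + ENNReal.ofReal η * w₁ k)
    (hle : ∀ η, 0 < η → η ≤ 1 → ∀ k, w η k ≤ w₁ k)
    {g : ℤ → ℝ≥0∞} (hg1 : ∑' k, g k ≠ ⊤) (hg : ∑' k, g k * w₁ k ≠ ⊤)
    {q : ℝ} (hq0 : 0 ≤ q) (hq : q < 1) :
    ∃ (η : ℝ) (D₀ : ℝ≥0∞), 0 < η ∧ η ≤ 1 ∧ D₀ ≠ ⊤ ∧
      ∀ (B : SeqSpace →L[ℂ] SeqSpace) (x z : SeqSpace) (Z : ℝ≥0∞),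
      TranslationInvariant B → ‖B‖ ≤ q → (∀ k, ‖B unitVec k‖ₑ ≤ g k) →
      weightedSum w₁ z ≤ Z → x = z + B x → weightedSum (w η) x ≤ D₀ * Z := by
  -- the weighted norm of the symbol of `B ^ J` is to be at most `1 / 4 + η * Q ^ J ≤ 1 / 2`
  obtain ⟨J, hJ1, hJ⟩ := exists_pow_weightedSum_le hg1 hq0 hq (δ := 4⁻¹) (by simp)
  set Q := ∑' k, g k * w₁ k with hQ
  obtain ⟨η, hη0, hη1, hηQ⟩ : ∃ η : ℝ, 0 < η ∧ η ≤ 1 ∧ ENNReal.ofReal η * Q ^ J ≤ 4⁻¹ := by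
    have hQJ : Q ^ J ≠ ⊤ := ENNReal.pow_ne_top hg
    have h1 : Tendsto (fun η : ℝ => ENNReal.ofReal η * Q ^ J) (𝓝[>] 0) (𝓝 0) := by
      have : Tendsto (fun η : ℝ => ENNReal.ofReal η * Q ^ J) (𝓝 0) (𝓝 (ENNReal.ofReal 0 * Q ^ J)) :=
        ((ENNReal.continuous_mul_const hQJ).comp ENNReal.continuous_ofReal).tendsto 0
      rw [ENNReal.ofReal_zero, zero_mul] at this
      exact this.mono_left nhdsWithin_le_nhds
    obtain ⟨η, ⟨h2, h3⟩⟩ := ((h1.eventually_le_const (show (0 : ℝ≥0∞) < 4⁻¹ by simp)).and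
      (Ioc_mem_nhdsGT (zero_lt_one (α := ℝ)))).exists
    exact ⟨η, h3.1, h3.2, h2⟩
  set G := ∑ i ∈ Finset.range J, Q ^ i with hG
  have hGtop : G ≠ ⊤ := by
    rw [hG]; exact (ENNReal.sum_lt_top.2 fun i _ => (ENNReal.pow_ne_top hg).lt_top).ne
  refine ⟨η, 2 * G, hη0, hη1, ENNReal.mul_ne_top (by simp) hGtop,
    fun B x z Z hB hBq hBg hz hx => ?_⟩
  set C := B ^ J with hC
  set y := ∑ i ∈ Finset.range J, (B ^ i) z with hy
  have hBQ : weightedSum w₁ (B unitVec) ≤ Q :=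
    ENNReal.tsum_le_tsum fun k => by gcongr; exact hBg k
  have hCQ : weightedSum w₁ (C unitVec) ≤ Q ^ J := by
    refine (hB.weightedSum_pow_apply_le hw₁ J unitVec).trans ?_
    rw [weightedSum_unitVec, hw₁0, mul_one]
    gcongr
  have hCη : weightedSum (w η) (C unitVec) ≤ 2⁻¹ := by
    calc _ ≤ weightedSum 1 (C unitVec) + ENNReal.ofReal η * weightedSum w₁ (C unitVec) := by
          unfold weightedSum
          rw [← ENNReal.tsum_mul_left, ← ENNReal.tsum_add]
          refine ENNReal.tsum_le_tsum fun k => ?_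
          calc _ ≤ ‖C unitVec k‖ₑ * (1 + ENNReal.ofReal η * w₁ k) := by
                gcongr; exact hww η hη0 hη1 k
            _ = _ := by rw [Pi.one_apply]; ring
      _ ≤ 4⁻¹ + 4⁻¹ := by
          gcongr
          · exact hJ B hB hBq hBg
          · exact le_trans (by gcongr) hηQ
      _ = 2⁻¹ := by
          rw [← two_mul, show (4 : ℝ≥0∞) = 2 * 2 by norm_num,
            ENNReal.mul_inv (by simp) (by simp), ← mul_assoc,
            ENNReal.mul_inv_cancel (by simp) (by simp), one_mul]
  have hyG : weightedSum (w η) y ≤ G * Z := by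
    calc _ ≤ weightedSum w₁ y := ENNReal.tsum_le_tsum fun k => by
          gcongr; exact hle η hη0 hη1 k
      _ ≤ _ := weightedSum_sum_le _ _ _
      _ ≤ _ := by
        rw [hG, Finset.sum_mul]
        refine Finset.sum_le_sum fun i _ => (hB.weightedSum_pow_apply_le hw₁ i z).trans ?_
        gcongr
  refine mem_of_eq_add_apply (C := C) (norm_pow_lt_one hq hBq hJ1) (z := y)
    (eq_sum_add_pow_apply hx J) (isClosed_setOf_weightedSum_le (w η) (hwtop η) (2 * G * Z)) ?_ ?_
  · change weightedSum (w η) (0 : SeqSpace) ≤ _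
    rw [weightedSum_zero]
    exact zero_le
  · intro v hv
    change weightedSum (w η) v ≤ _ at hv
    change weightedSum (w η) (y + C v : SeqSpace) ≤ _
    calc _ ≤ weightedSum (w η) y + weightedSum (w η) (C v) := weightedSum_add_le _ _ _
      _ ≤ G * Z + 2⁻¹ * (2 * G * Z) := by
          gcongr
          refine ((hB.pow J).weightedSum_apply_le (hw η hη0) v).trans ?_
          gcongr
      _ = _ := by
          rw [mul_assoc 2 G Z, ← mul_assoc, ENNReal.inv_mul_cancel (by simp) (by simp), one_mul,
            two_mul]

/-! ### Positive definite operators -/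

theorem IsHPD.isUnit {L : SeqSpace →L[ℂ] SeqSpace} (h : IsHPD L) : IsUnit L := by
  obtain ⟨m, hm, hL⟩ := h.lowerBound
  refine ContinuousLinearMap.isUnit_of_forall_le_norm_inner_map L (c := ⟨m, hm.le⟩) hm fun x => ?_
  rw [mul_comm]
  exact (hL x).trans ((Complex.re_le_norm _))

theorem opInv_apply_apply {L : SeqSpace →L[ℂ] SeqSpace} (h : IsUnit L) (x : SeqSpace) :
    opInv L (L x) = x := by
  rw [← mul_apply_eq_comp, opInv, Ring.inverse_mul_cancel _ h, one_apply_eq_self]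

theorem apply_opInv_apply {L : SeqSpace →L[ℂ] SeqSpace} (h : IsUnit L) (x : SeqSpace) :
    L (opInv L x) = x := by
  rw [← mul_apply_eq_comp, opInv, Ring.mul_inverse_cancel _ h, one_apply_eq_self]

theorem IsHPD.norm_opInv_pos {L : SeqSpace →L[ℂ] SeqSpace} (h : IsHPD L) : 0 < ‖opInv L‖ := by
  refine norm_pos_iff.2 fun h0 => ?_
  have h1 := opInv_apply_apply h.isUnit unitVec
  rw [h0] at h1
  have h2 := norm_unitVec
  rw [← h1] at h2
  simp at h2

theorem norm_le_norm_opInv_mul {L : SeqSpace →L[ℂ] SeqSpace} (h : IsUnit L) (x : SeqSpace) :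
    ‖x‖ ≤ ‖opInv L‖ * ‖L x‖ := by
  conv_lhs => rw [← opInv_apply_apply h x]
  exact ContinuousLinearMap.le_opNorm _ _

/-- The optimal lower bound of a positive definite operator is `1 / ‖L⁻¹‖`. It comes from
positivity of the quadratic form at `x - t L⁻¹ x` with `t = 1 / ‖L⁻¹‖`. -/
theorem IsHPD.norm_sq_le {L : SeqSpace →L[ℂ] SeqSpace} (h : IsHPD L) (x : SeqSpace) :
    ‖x‖ ^ 2 ≤ ‖opInv L‖ * (inner ℂ (L x) x).re := by
  set M := ‖opInv L‖ with hM
  have hM0 : 0 < M := h.norm_opInv_pos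
  set u := opInv L x with hu
  have hLu : L u = x := apply_opInv_apply h.isUnit x
  have hpos : 0 ≤ (inner ℂ (L (x - ((M⁻¹ : ℝ) : ℂ) • u)) (x - ((M⁻¹ : ℝ) : ℂ) • u)).re := by
    obtain ⟨m, hm, hL⟩ := h.lowerBound
    exact (mul_nonneg hm.le (sq_nonneg _)).trans (hL _)
  have hsymm : inner ℂ (L x) u = inner ℂ x x :=
    (h.selfAdjoint.isSymmetric x u).trans (congrArg (inner ℂ x) hLu)
  have hxu : (inner ℂ x u).re ≤ M * ‖x‖ ^ 2 := by
    calc (inner ℂ x u).re ≤ ‖inner ℂ x u‖ := Complex.re_le_norm _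
      _ ≤ ‖x‖ * ‖u‖ := norm_inner_le_norm _ _
      _ ≤ ‖x‖ * (M * ‖x‖) := by gcongr; exact ContinuousLinearMap.le_opNorm _ _
      _ = _ := by ring
  have hxx : (inner ℂ x x).re = ‖x‖ ^ 2 := inner_self_eq_norm_sq (𝕜 := ℂ) x
  rw [map_sub, map_smul, hLu, inner_sub_left, inner_sub_right, inner_sub_right, inner_smul_left,
    inner_smul_left, inner_smul_right, inner_smul_right, hsymm, Complex.conj_ofReal] at hpos
  simp only [Complex.sub_re, Complex.re_ofReal_mul, hxx] at hpos
  have h1 : M⁻¹ * (M⁻¹ * (inner ℂ x u).re) ≤ M⁻¹ * ‖x‖ ^ 2 := by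
    gcongr
    rw [inv_mul_le_iff₀ hM0]
    exact hxu
  have h2 : M⁻¹ * ‖x‖ ^ 2 ≤ (inner ℂ (L x) x).re := by linarith
  rwa [inv_mul_le_iff₀ hM0] at h2

theorem IsHPD.one_le_condNumber {L : SeqSpace →L[ℂ] SeqSpace} (h : IsHPD L) :
    1 ≤ condNumber L := by
  have h1 := norm_le_norm_opInv_mul h.isUnit unitVec
  have h2 := L.le_opNorm unitVec
  rw [norm_unitVec] at h1 h2
  rw [condNumber, mul_comm]
  calc 1 ≤ ‖opInv L‖ * ‖L unitVec‖ := h1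
    _ ≤ _ := by gcongr; simpa using h2

theorem IsHPD.norm_pos {L : SeqSpace →L[ℂ] SeqSpace} (h : IsHPD L) : 0 < ‖L‖ := by
  have h1 := h.one_le_condNumber
  rw [condNumber] at h1
  by_contra h2
  rw [le_antisymm (not_lt.1 h2) (norm_nonneg _), zero_mul] at h1
  linarith

/-- Rescaling `L x = y` to a fixed point equation: with `μ = m / ‖L‖²`, `m = 1 / ‖L⁻¹‖`, the
operator `1 - μ L` is a contraction whose constant depends on the condition number only. -/
theorem IsHPD.norm_one_sub_smul_le {L : SeqSpace →L[ℂ] SeqSpace} (h : IsHPD L) {κ : ℝ}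
    (hκ : condNumber L ≤ κ) :
    ‖1 - (((‖opInv L‖ * ‖L‖ ^ 2)⁻¹ : ℝ) : ℂ) • L‖ ≤ √(1 - (κ ^ 2)⁻¹) := by
  set a := ‖opInv L‖ with ha
  set M := ‖L‖ with hM
  have ha0 : 0 < a := h.norm_opInv_pos
  have hM0 : 0 < M := h.norm_pos
  set μ : ℝ := (a * M ^ 2)⁻¹ with hμ
  have hμ0 : 0 < μ := by positivity
  have hcond : M * a ≤ κ := hκ
  refine ContinuousLinearMap.opNorm_le_bound _ (Real.sqrt_nonneg _) fun x => ?_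
  refine (sq_le_sq₀ (norm_nonneg _) (by positivity)).1 ?_
  have hcalc : ‖(1 - (μ : ℂ) • L) x‖ ^ 2
      = ‖x‖ ^ 2 - 2 * (μ * (inner ℂ (L x) x).re) + μ ^ 2 * ‖L x‖ ^ 2 := by
    change ‖x - (μ : ℂ) • L x‖ ^ 2 = _
    rw [@norm_sub_sq ℂ, inner_smul_right, norm_smul, mul_pow]
    have : (inner ℂ x (L x)).re = (inner ℂ (L x) x).re := inner_re_symm (𝕜 := ℂ) x (L x)
    simp [this]
  have h1 : ‖L x‖ ≤ M * ‖x‖ := L.le_opNorm x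
  have h2 := h.norm_sq_le x
  have h3 : ‖L x‖ ^ 2 ≤ M ^ 2 * ‖x‖ ^ 2 := by
    rw [← mul_pow]; exact pow_le_pow_left₀ (norm_nonneg _) h1 2
  have h4 : a⁻¹ * ‖x‖ ^ 2 ≤ (inner ℂ (L x) x).re := by
    rwa [inv_mul_le_iff₀ ha0]
  have hκ0 : 0 < κ := lt_of_lt_of_le (by positivity) hcond
  have h5 : (κ ^ 2)⁻¹ ≤ ((M * a) ^ 2)⁻¹ := by gcongr
  have h6 : ((M * a) ^ 2)⁻¹ ≤ 1 := inv_le_one_of_one_le₀ (one_le_pow₀ h.one_le_condNumber)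
  calc ‖(1 - (μ : ℂ) • L) x‖ ^ 2
      ≤ ‖x‖ ^ 2 - 2 * (μ * (a⁻¹ * ‖x‖ ^ 2)) + μ ^ 2 * (M ^ 2 * ‖x‖ ^ 2) := by
        rw [hcalc]; gcongr
    _ = (1 - ((M * a) ^ 2)⁻¹) * ‖x‖ ^ 2 := by
        rw [hμ]; field_simp; ring
    _ ≤ (1 - (κ ^ 2)⁻¹) * ‖x‖ ^ 2 := by gcongr
    _ = (√(1 - (κ ^ 2)⁻¹) * ‖x‖) ^ 2 := by
        rw [mul_pow, Real.sq_sqrt (by linarith)]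

/-! ### Finite sections -/

/-- Extension by zero of a vector on `{-n+1, …, n-1}`. -/
noncomputable def extendZero (n : ℕ) (v : SectionIndex n → ℂ) : SeqSpace :=
  ∑ k : SectionIndex n, lp.single 2 (k : ℤ) (v k)

theorem extendZero_apply_coe {n : ℕ} (v : SectionIndex n → ℂ) (k : SectionIndex n) :
    extendZero n v k = v k := by
  simp only [extendZero, lp.coeFn_sum, Finset.sum_apply, lp.coeFn_single, Pi.single_apply]
  rw [Finset.sum_eq_single k]
  · simp
  · intro b _ hb
    rw [if_neg fun h => hb (Subtype.ext h.symm)]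
  · simp

theorem extendZero_apply_of_notMem {n : ℕ} (v : SectionIndex n → ℂ) {k : ℤ}
    (hk : k ∉ Finset.Icc (-(n : ℤ) + 1) ((n : ℤ) - 1)) : extendZero n v k = 0 := by
  simp only [extendZero, lp.coeFn_sum, Finset.sum_apply, lp.coeFn_single, Pi.single_apply]
  refine Finset.sum_eq_zero fun b _ => if_neg ?_
  rintro rfl
  exact hk b.2

theorem IsToeplitz.apply_extendZero {L : SeqSpace →L[ℂ] SeqSpace} {a : ℤ → ℂ}
    (h : IsToeplitz L a) {n : ℕ} (v : SectionIndex n → ℂ) (k : SectionIndex n) :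
    L (extendZero n v) k = (finiteSection a n).mulVec v k := by
  rw [extendZero, map_sum, lp.coeFn_sum, Finset.sum_apply]
  refine Finset.sum_congr rfl fun l _ => ?_
  have : lp.single (E := fun _ : ℤ => ℂ) 2 (l : ℤ) (v l) = v l • lp.single 2 (l : ℤ) (1 : ℂ) := by
    rw [← lp.single_smul]; simp
  rw [this, map_smul, lp.coeFn_smul, Pi.smul_apply, h, smul_eq_mul, mul_comm]
  rfl

/-- Galerkin orthogonality. -/
theorem inner_extendZero_eq_zero {n : ℕ} {u : SeqSpace} (hu : ∀ k : SectionIndex n, u k = 0)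
    (v : SectionIndex n → ℂ) : inner ℂ u (extendZero n v) = 0 := by
  rw [extendZero, inner_sum]
  refine Finset.sum_eq_zero fun k _ => ?_
  rw [lp.inner_single_right, hu k, inner_zero_left]

theorem IsHPD.isUnit_finiteSection {L : SeqSpace →L[ℂ] SeqSpace} {a : ℤ → ℂ}
    (hT : IsToeplitz L a) (h : IsHPD L) (n : ℕ) : IsUnit (finiteSection a n) := by
  rw [← Matrix.mulVec_injective_iff_isUnit]
  refine (injective_iff_map_eq_zero (finiteSection a n).mulVecLin).2 fun v hv => ?_
  have h1 : inner ℂ (L (extendZero n v)) (extendZero n v) = 0 :=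
    inner_extendZero_eq_zero (fun k => by
      rw [hT.apply_extendZero]
      exact congrFun hv k) v
  have h2 := h.norm_sq_le (extendZero n v)
  rw [h1, Complex.zero_re, mul_zero] at h2
  have h3 : extendZero n v = 0 := by
    rw [← norm_eq_zero]; exact pow_eq_zero_iff (two_ne_zero) |>.1 (le_antisymm h2 (sq_nonneg _))
  ext k
  rw [← extendZero_apply_coe v k, h3]
  rfl

/-- Quasi-optimality of the finite section method (Céa's lemma): its error is controlled by the
part of the solution outside the section. -/
theorem IsHPD.norm_sub_sectionSolution_le {L : SeqSpace →L[ℂ] SeqSpace} {a : ℤ → ℂ}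
    {x y : SeqSpace} (hT : IsToeplitz L a) (h : IsHPD L) (hxy : L x = y) (n : ℕ) :
    ‖x - sectionSolution a y n‖
      ≤ (1 + condNumber L) * ‖x - extendZero n fun k => x k‖ := by
  set w := (finiteSection a n)⁻¹.mulVec (truncation y n) with hw
  have hxn : sectionSolution a y n = extendZero n w := rfl
  set p := extendZero n fun k => x k with hp
  set d := extendZero n fun k : SectionIndex n => x k - w k with hd
  have hdp : d = p - extendZero n w := by
    rw [hd, hp]
    simp only [extendZero, lp.single_sub, Finset.sum_sub_distrib]
  have hLw : ∀ k : SectionIndex n, L (extendZero n w) k = y k := fun k => by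
    rw [hT.apply_extendZero, hw, Matrix.mulVec_mulVec, Matrix.mul_nonsing_inv _
      ((Matrix.isUnit_iff_isUnit_det _).1 (h.isUnit_finiteSection hT n)), Matrix.one_mulVec]
    rfl
  -- `L d = -L (x - p)` inside the section
  have horth : inner ℂ (L d + L (x - p)) d = 0 := by
    refine inner_extendZero_eq_zero (fun k => ?_) _
    have : L d + L (x - p) = y - L (extendZero n w) := by
      rw [← map_add, hdp, ← hxy, ← map_sub]; congr 1; abel
    rw [this, lp.coeFn_sub, Pi.sub_apply, hLw, sub_self]
  have h1 : (inner ℂ (L d) d).re ≤ ‖L‖ * ‖x - p‖ * ‖d‖ := by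
    rw [inner_add_left, add_eq_zero_iff_eq_neg] at horth
    rw [horth]
    calc _ ≤ ‖-inner ℂ (L (x - p)) d‖ := Complex.re_le_norm _
      _ = ‖inner ℂ (L (x - p)) d‖ := norm_neg _
      _ ≤ ‖L (x - p)‖ * ‖d‖ := norm_inner_le_norm _ _
      _ ≤ _ := by gcongr; exact L.le_opNorm _
  have h2 : ‖d‖ ≤ condNumber L * ‖x - p‖ := by
    rcases (norm_nonneg d).eq_or_lt with h0 | h0
    · rw [← h0]
      exact mul_nonneg (zero_le_one.trans h.one_le_condNumber) (norm_nonneg _)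
    · refine le_of_mul_le_mul_right ?_ h0
      calc ‖d‖ * ‖d‖ = ‖d‖ ^ 2 := (sq _).symm
        _ ≤ ‖opInv L‖ * (inner ℂ (L d) d).re := h.norm_sq_le d
        _ ≤ ‖opInv L‖ * (‖L‖ * ‖x - p‖ * ‖d‖) := by gcongr
        _ = _ := by rw [condNumber]; ring
  calc ‖x - sectionSolution a y n‖ = ‖(x - p) + d‖ := by rw [hxn, hdp]; congr 1; abel
    _ ≤ ‖x - p‖ + ‖d‖ := norm_add_le _ _
    _ ≤ _ := by linarith

/-! ### Truncation errors -/

theorem sub_extendZero_apply (x : SeqSpace) (n : ℕ) (k : ℤ) :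
    (x - extendZero n fun k => x k : SeqSpace) k = if (n : ℤ) ≤ |k| then x k else 0 := by
  rw [lp.coeFn_sub, Pi.sub_apply]
  have hiff : (n : ℤ) ≤ |k| ↔ k ∉ Finset.Icc (-(n : ℤ) + 1) ((n : ℤ) - 1) := by
    rw [le_abs, Finset.mem_Icc]; omega
  split_ifs with h
  · rw [extendZero_apply_of_notMem _ (hiff.1 h), sub_zero]
  · rw [hiff, not_not] at h
    rw [extendZero_apply_coe (fun k : SectionIndex n => x k) ⟨k, h⟩, sub_self]

theorem enorm_le_weightedSum_one (v : SeqSpace) : ‖v‖ₑ ≤ weightedSum 1 v := by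
  have h := lp.hasSum_single (p := 2) (by norm_num) v
  rw [← h.tsum_eq]
  refine enorm_tsum_le_tsum_enorm.trans_eq (tsum_congr fun k => ?_)
  rw [← ofReal_norm, lp.norm_single (by norm_num), ofReal_norm, h.tsum_eq, Pi.one_apply, mul_one]

theorem enorm_sq_eq_tsum (v : SeqSpace) : ‖v‖ₑ ^ 2 = ∑' k, ‖v k‖ₑ ^ 2 := by
  have h := lp.hasSum_norm (p := 2) (by norm_num) v
  simp only [ENNReal.toReal_ofNat, Real.rpow_ofNat] at h
  simp only [← ofReal_norm, ← ENNReal.ofReal_pow (norm_nonneg _)]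
  rw [← h.tsum_eq, ENNReal.ofReal_tsum_of_nonneg (fun _ => by positivity) h.summable]

theorem tsum_int_natAbs_le (f : ℕ → ℝ≥0∞) : ∑' k : ℤ, f k.natAbs ≤ 2 * ∑' m, f m := by
  rw [tsum_of_nat_of_neg_add_one ENNReal.summable ENNReal.summable, two_mul]
  refine add_le_add ?_ ?_
  · simp
  · refine le_trans (le_of_eq (tsum_congr fun m => ?_))
      (ENNReal.tsum_comp_le_tsum_of_injective (add_left_injective 1) f)
    congr 1

theorem tsum_inv_sq_tail_le {n : ℕ} (hn : 1 ≤ n) :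
    ∑' m : ℕ, (if n ≤ m then ENNReal.ofReal (((1 + m : ℝ) ^ 2)⁻¹) else 0)
      ≤ ENNReal.ofReal (n : ℝ)⁻¹ := by
  refine ENNReal.tsum_le_of_sum_range_le fun M => ?_
  have hn0 : (0 : ℝ) < n := by exact_mod_cast hn
  have key : ∑ m ∈ Finset.range M, (if n ≤ m then ((1 + m : ℝ) ^ 2)⁻¹ else 0)
      ≤ (n : ℝ)⁻¹ - ((max n M : ℕ) : ℝ)⁻¹ := by
    induction M with
    | zero => simp
    | succ M ih =>
      rw [Finset.sum_range_succ]
      split_ifs with h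
      · rw [max_eq_right h] at ih
        rw [max_eq_right (by omega)]
        have hM : (0 : ℝ) < M := by exact_mod_cast (by omega : 0 < M)
        have : ((1 + M : ℝ) ^ 2)⁻¹ ≤ (M : ℝ)⁻¹ - ((M + 1 : ℕ) : ℝ)⁻¹ := by
          push_cast
          rw [inv_sub_inv hM.ne' (by positivity), inv_eq_one_div]
          rw [div_le_div_iff₀ (by positivity) (by positivity)]
          nlinarith
        linarith
      · rw [max_eq_left (by omega)] at ih ⊢
        simpa using ih
  calc _ = ENNReal.ofReal (∑ m ∈ Finset.range M, (if n ≤ m then ((1 + m : ℝ) ^ 2)⁻¹ else 0)) := by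
        rw [ENNReal.ofReal_sum_of_nonneg fun m _ => by split_ifs <;> positivity]
        refine Finset.sum_congr rfl fun m _ => ?_
        split_ifs <;> simp
    _ ≤ _ := by
        refine ENNReal.ofReal_le_ofReal (key.trans ?_)
        simp

theorem norm_sub_extendZero_le_of_weightedSum {x : SeqSpace} {r : ℝ} (hr : 0 ≤ r) {D : ℝ}
    (hD : 0 ≤ D)
    (h : weightedSum (fun k : ℤ => ENNReal.ofReal (Real.exp (r * |(k : ℝ)|))) x
      ≤ ENNReal.ofReal D) (n : ℕ) :
    ‖x - extendZero n fun k => x k‖ ≤ D * Real.exp (-r * n) := by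
  rw [← ENNReal.ofReal_le_ofReal_iff (by positivity), ofReal_norm]
  refine (enorm_le_weightedSum_one _).trans ?_
  rw [ENNReal.ofReal_mul hD]
  refine le_trans ?_ (mul_le_mul' h le_rfl)
  unfold weightedSum
  rw [← ENNReal.tsum_mul_right]
  refine ENNReal.tsum_le_tsum fun k => ?_
  rw [sub_extendZero_apply, Pi.one_apply, mul_one]
  split_ifs with hk
  · rw [mul_assoc, ← ENNReal.ofReal_mul (by positivity), ← Real.exp_add]
    refine le_mul_of_one_le_right' (ENNReal.one_le_ofReal.2 (Real.one_le_exp ?_))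
    have : (n : ℝ) ≤ |(k : ℝ)| := by exact_mod_cast hk
    nlinarith
  · simp

theorem norm_sub_extendZero_le_of_dominated {x : SeqSpace} {s D : ℝ} (hs : 1 < s) (hD : 0 ≤ D)
    (h : ∀ k : ℤ, ‖x k‖ₑ ≤ ENNReal.ofReal D * ENNReal.ofReal ((1 + |(k : ℝ)|) ^ (-s)))
    {n : ℕ} (hn : 1 ≤ n) :
    ‖x - extendZero n fun k => x k‖ ≤ √2 * D * (n : ℝ) ^ ((1 - 2 * s) / 2) := by
  have hn0 : (0 : ℝ) < n := by exact_mod_cast hn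
  refine (sq_le_sq₀ (norm_nonneg _) (by positivity)).1 ?_
  rw [← ENNReal.ofReal_le_ofReal_iff (by positivity), ENNReal.ofReal_pow (norm_nonneg _),
    ofReal_norm, enorm_sq_eq_tsum]
  have hpow : ((n : ℝ) ^ ((1 - 2 * s) / 2)) ^ 2 = (n : ℝ) ^ (2 - 2 * s) * (n : ℝ)⁻¹ := by
    rw [← Real.rpow_natCast, ← Real.rpow_mul hn0.le, ← Real.rpow_neg_one, ← Real.rpow_add hn0]
    congr 1
    push_cast
    ring
  -- since `2 s > 2`, all but two of the powers of `1 + |k|` are estimated by powers of `n`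
  have hterm : ∀ k : ℤ, ‖(x - extendZero n fun k => x k : SeqSpace) k‖ₑ ^ 2
      ≤ ENNReal.ofReal (D ^ 2 * (n : ℝ) ^ (2 - 2 * s)) *
        (if n ≤ k.natAbs then ENNReal.ofReal (((1 + k.natAbs : ℝ) ^ 2)⁻¹) else 0) := fun k => by
    rw [sub_extendZero_apply]
    have hiff : (n : ℤ) ≤ |k| ↔ n ≤ k.natAbs := by rw [Int.abs_eq_natAbs]; norm_cast
    simp only [hiff]
    split_ifs with hk
    · have habs : |(k : ℝ)| = k.natAbs := by rw [Nat.cast_natAbs, Int.cast_abs]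
      have h1 := h k
      rw [habs] at h1
      refine (pow_le_pow_left' h1 2).trans ?_
      rw [← ENNReal.ofReal_mul hD, ← ENNReal.ofReal_pow (by positivity),
        ← ENNReal.ofReal_mul (by positivity)]
      refine ENNReal.ofReal_le_ofReal ?_
      have hk' : (n : ℝ) ≤ 1 + k.natAbs := by
        have : (n : ℝ) ≤ k.natAbs := by exact_mod_cast hk
        linarith
      have hpos : (0 : ℝ) < 1 + k.natAbs := by positivity
      have h2 : (1 + k.natAbs : ℝ) ^ (2 - 2 * s) ≤ (n : ℝ) ^ (2 - 2 * s) :=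
        Real.rpow_le_rpow_of_nonpos hn0 hk' (by linarith)
      have h3 : ((1 + k.natAbs : ℝ) ^ (-s)) ^ 2
          = (1 + k.natAbs : ℝ) ^ (2 - 2 * s) * ((1 + k.natAbs : ℝ) ^ 2)⁻¹ := by
        rw [← Real.rpow_natCast, ← Real.rpow_mul hpos.le, ← Real.rpow_natCast (1 + _) 2,
          ← Real.rpow_neg hpos.le, ← Real.rpow_add hpos]
        congr 1
        push_cast
        ring
      rw [mul_pow, h3, ← mul_assoc]
      gcongr
    · simp
  calc _ ≤ _ := ENNReal.tsum_le_tsum hterm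
    _ ≤ ENNReal.ofReal (D ^ 2 * (n : ℝ) ^ (2 - 2 * s)) * (2 * ENNReal.ofReal (n : ℝ)⁻¹) := by
        rw [ENNReal.tsum_mul_left]
        gcongr
        refine (tsum_int_natAbs_le fun m =>
          if n ≤ m then ENNReal.ofReal (((1 + m : ℝ) ^ 2)⁻¹) else 0).trans ?_
        gcongr
        exact tsum_inv_sq_tail_le hn
    _ = _ := by
        rw [show (2 : ℝ≥0∞) = ENNReal.ofReal 2 by simp, ← ENNReal.ofReal_mul (by norm_num),
          ← ENNReal.ofReal_mul (by positivity)]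
        congr 1
        rw [mul_pow, hpow, mul_pow, Real.sq_sqrt (by norm_num)]
        ring

/-! ### Summability and submultiplicativity of the weights -/

theorem tsum_polynomial_weight_ne_top {s : ℝ} (hs : 1 < s) :
    ∑' k : ℤ, ENNReal.ofReal ((1 + |(k : ℝ)|) ^ (-s)) ≠ ⊤ := by
  have h1 : Summable fun m : ℕ => (1 + (m : ℝ)) ^ (-s) := by
    have := (summable_nat_add_iff 1).2 (Real.summable_nat_rpow.2 (by linarith : -s < -1))
    refine this.congr fun m => ?_
    push_cast
    rw [add_comm]
  refine ne_top_of_le_ne_top ?_ (le_trans (le_of_eq (tsum_congr fun k => ?_))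
    (tsum_int_natAbs_le fun m => ENNReal.ofReal ((1 + (m : ℝ)) ^ (-s))))
  · rw [← ENNReal.ofReal_tsum_of_nonneg (fun m => by positivity) h1]
    exact ENNReal.mul_ne_top (by simp) (by simp)
  · rw [Nat.cast_natAbs, Int.cast_abs]

theorem tsum_exponential_weight_ne_top {γ : ℝ} (hγ : 0 < γ) :
    ∑' k : ℤ, ENNReal.ofReal (Real.exp (-γ * |(k : ℝ)|)) ≠ ⊤ := by
  have h1 : Summable fun m : ℕ => Real.exp (-γ * m) := by
    have := Real.summable_exp_nat_mul_iff.2 (neg_lt_zero.2 hγ)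
    refine this.congr fun m => ?_
    rw [mul_comm]
  refine ne_top_of_le_ne_top ?_ (le_trans (le_of_eq (tsum_congr fun k => ?_))
    (tsum_int_natAbs_le fun m => ENNReal.ofReal (Real.exp (-γ * m))))
  · rw [← ENNReal.ofReal_tsum_of_nonneg (fun m => by positivity) h1]
    exact ENNReal.mul_ne_top (by simp) (by simp)
  · rw [Nat.cast_natAbs, Int.cast_abs]

theorem polynomial_weight_le_or {s : ℝ} (hs : 1 < s) (k l : ℤ) :
    ENNReal.ofReal ((1 + |(l : ℝ)|) ^ (-s))
        ≤ ENNReal.ofReal (2 ^ s) * ENNReal.ofReal ((1 + |(k : ℝ)|) ^ (-s)) ∨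
      ENNReal.ofReal ((1 + |((k - l : ℤ) : ℝ)|) ^ (-s))
        ≤ ENNReal.ofReal (2 ^ s) * ENNReal.ofReal ((1 + |(k : ℝ)|) ^ (-s)) := by
  have aux : ∀ t : ℝ, (1 + |(k : ℝ)|) / 2 ≤ t → ENNReal.ofReal (t ^ (-s))
      ≤ ENNReal.ofReal (2 ^ s) * ENNReal.ofReal ((1 + |(k : ℝ)|) ^ (-s)) := fun t ht => by
    rw [← ENNReal.ofReal_mul (by positivity)]
    refine ENNReal.ofReal_le_ofReal ((Real.rpow_le_rpow_of_nonpos (by positivity) ht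
      (by linarith)).trans_eq ?_)
    rw [Real.div_rpow (by positivity) (by norm_num), Real.rpow_neg (by norm_num : (0 : ℝ) ≤ 2),
      div_inv_eq_mul, mul_comm]
  have htri : |(k : ℝ)| ≤ |(l : ℝ)| + |((k - l : ℤ) : ℝ)| := by
    push_cast
    have := abs_add_le (l : ℝ) (k - l)
    rwa [add_sub_cancel] at this
  rcases le_total ((1 + |(k : ℝ)|) / 2) (1 + |(l : ℝ)|) with h | h
  · exact Or.inl (aux _ h)
  · exact Or.inr (aux _ (by linarith))

theorem exponential_weight_add_le {r : ℝ} (hr : 0 ≤ r) (k l : ℤ) :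
    ENNReal.ofReal (Real.exp (r * |((k + l : ℤ) : ℝ)|))
      ≤ ENNReal.ofReal (Real.exp (r * |(k : ℝ)|)) * ENNReal.ofReal (Real.exp (r * |(l : ℝ)|)) := by
  rw [← ENNReal.ofReal_mul (by positivity), ← Real.exp_add, ← mul_add]
  push_cast
  gcongr
  exact abs_add_le _ _

theorem exp_mul_le_one_add {η : ℝ} (h0 : 0 ≤ η) (h1 : η ≤ 1) (t : ℝ) :
    Real.exp (η * t) ≤ 1 + η * Real.exp t := by
  have h := convexOn_exp.2 (Set.mem_univ 0) (Set.mem_univ t) (sub_nonneg.2 h1) h0 (by ring)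
  simp only [smul_eq_mul, mul_zero, zero_add, Real.exp_zero, mul_one] at h
  linarith

/-! ### Decay of the solution -/

/-- Normalization of the equation `L x = y`: it is equivalent to a fixed point equation for a
contraction whose norm and symbol are controlled by `κ` and `R` only. -/
theorem IsHPD.exists_contraction {L : SeqSpace →L[ℂ] SeqSpace} {a : ℤ → ℂ} {x y : SeqSpace}
    {c c' κ R : ℝ} (hT : IsToeplitz L a) (h : IsHPD L) (hxy : L x = y)
    (hκ : condNumber L ≤ κ) (hc : c ≤ R * ‖L‖) {ρ : ℤ → ℝ} (hρ : ∀ k, 0 ≤ ρ k) (hρ0 : ρ 0 = 1)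
    (ha : ∀ k, ‖a k‖ ≤ c * ρ k) (hy : ∀ k, ‖y k‖ ≤ c' * ρ k) :
    ∃ (B : SeqSpace →L[ℂ] SeqSpace) (z : SeqSpace), TranslationInvariant B ∧
      ‖B‖ ≤ √(1 - (κ ^ 2)⁻¹) ∧
      (∀ k, ‖B unitVec k‖ₑ ≤ ENNReal.ofReal (1 + max R 0) * ENNReal.ofReal (ρ k)) ∧
      (∀ k, ‖z k‖ₑ ≤ ENNReal.ofReal (‖opInv L‖ * c') * ENNReal.ofReal (ρ k)) ∧ x = z + B x := by
  have hA0 := h.norm_opInv_pos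
  have hM0 := h.norm_pos
  have hMA : 1 ≤ ‖L‖ * ‖opInv L‖ := h.one_le_condNumber
  set μ : ℝ := (‖opInv L‖ * ‖L‖ ^ 2)⁻¹ with hμ
  have hμ0 : 0 < μ := by positivity
  have hμM : μ * ‖L‖ ≤ 1 := by
    have : μ * ‖L‖ = (‖L‖ * ‖opInv L‖)⁻¹ := by rw [hμ]; field_simp
    rw [this]
    exact inv_le_one_of_one_le₀ hMA
  have hμA : μ ≤ ‖opInv L‖ := by
    rw [hμ, inv_le_iff_one_le_mul₀ (by positivity)]
    calc (1 : ℝ) ≤ (‖L‖ * ‖opInv L‖) ^ 2 := one_le_pow₀ hMA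
      _ = _ := by ring
  have hc'0 : 0 ≤ c' := by
    have := (norm_nonneg _).trans (hy 0)
    rwa [hρ0, mul_one] at this
  refine ⟨1 - (μ : ℂ) • L, (μ : ℂ) • y, TranslationInvariant.one.sub (hT.translationInvariant.smul _),
    h.norm_one_sub_smul_le hκ, fun k => ?_, fun k => ?_, ?_⟩
  · have h1 : (1 - (μ : ℂ) • L) unitVec k = unitVec k - (μ : ℂ) * a k := by
      rw [← hT.apply_unitVec k]; rfl
    rw [h1, ← ofReal_norm, ← ENNReal.ofReal_mul (by positivity)]
    refine ENNReal.ofReal_le_ofReal ?_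
    have h2 : ‖unitVec k‖ ≤ ρ k := by
      rcases eq_or_ne k 0 with rfl | hk
      · simp [hρ0]
      · rw [lp.single_apply_ne _ _ _ hk]; simpa using hρ k
    have h3 : ‖(μ : ℂ) * a k‖ ≤ max R 0 * ρ k := by
      rw [norm_mul, Complex.norm_real, Real.norm_of_nonneg hμ0.le]
      calc μ * ‖a k‖ ≤ μ * (max R 0 * ‖L‖ * ρ k) := by
            gcongr
            refine (ha k).trans (mul_le_mul_of_nonneg_right (hc.trans ?_) (hρ k))
            gcongr
            exact le_max_left _ _
        _ = (μ * ‖L‖) * (max R 0 * ρ k) := by ring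
        _ ≤ 1 * (max R 0 * ρ k) := by
            gcongr
            exact mul_nonneg (le_max_right _ _) (hρ k)
        _ = _ := one_mul _
    calc _ ≤ _ := norm_sub_le _ _
      _ ≤ ρ k + max R 0 * ρ k := add_le_add h2 h3
      _ = _ := by ring
  · rw [← ENNReal.ofReal_mul (by positivity), ← ofReal_norm, lp.coeFn_smul, Pi.smul_apply,
      norm_smul, Complex.norm_real, Real.norm_of_nonneg hμ0.le]
    refine ENNReal.ofReal_le_ofReal ?_
    calc μ * ‖y k‖ ≤ ‖opInv L‖ * (c' * ρ k) := by gcongr; exact hy k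
      _ = _ := by ring
  · change x = (μ : ℂ) • y + (x - (μ : ℂ) • L x)
    rw [hxy]
    abel

theorem sqrt_one_sub_inv_sq_lt_one {κ : ℝ} (hκ : 0 < κ) : √(1 - (κ ^ 2)⁻¹) < 1 := by
  rw [Real.sqrt_lt' one_pos]
  have : 0 < (κ ^ 2)⁻¹ := by positivity
  linarith

theorem exists_polynomial_bound {s : ℝ} (hs : 1 < s) (κ R : ℝ) :
    ∃ c₁ : ℝ,
      ∀ (L : SeqSpace →L[ℂ] SeqSpace) (a : ℤ → ℂ) (x y : SeqSpace) (c c' : ℝ),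
        IsToeplitz L a → IsHPD L → L x = y →
        condNumber L ≤ κ → c ≤ R * ‖L‖ →
        (∀ k : ℤ, ‖a k‖ ≤ c * (1 + |(k : ℝ)|) ^ (-s)) →
        (∀ k : ℤ, ‖y k‖ ≤ c' * (1 + |(k : ℝ)|) ^ (-s)) →
        ∀ n : ℕ, 1 ≤ n →
          ‖x - sectionSolution a y n‖
            ≤ c₁ * (‖opInv L‖ * c') * (n : ℝ) ^ ((1 - 2 * s) / 2) := by
  -- `max κ 1` replaces `κ`, since `1 ≤ κ` is known only once an operator is given
  obtain ⟨D, hD, H⟩ := exists_dominated_bound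
    (ω := fun k : ℤ => ENNReal.ofReal ((1 + |(k : ℝ)|) ^ (-s))) (A := ENNReal.ofReal (2 ^ s))
    ENNReal.ofReal_ne_top (by simp) (polynomial_weight_le_or hs) (tsum_polynomial_weight_ne_top hs)
    (Real.sqrt_nonneg _) (sqrt_one_sub_inv_sq_lt_one (lt_max_of_lt_right one_pos : 0 < max κ 1))
    (K := ENNReal.ofReal (1 + max R 0)) ENNReal.ofReal_ne_top
  refine ⟨(1 + κ) * (√2 * D.toReal), fun L a x y c c' hT h hxy hκ hc ha hy n hn => ?_⟩
  obtain ⟨B, z, hB, hBq, hBK, hz, hx⟩ := h.exists_contraction hT hxy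
    (hκ.trans (le_max_left κ 1)) hc (fun k => by positivity) (by simp) ha hy
  have hc'0 : 0 ≤ c' := by simpa using (norm_nonneg _).trans (hy 0)
  have h1 := norm_sub_extendZero_le_of_dominated hs
    (D := D.toReal * (‖opInv L‖ * c')) (x := x) (by positivity) (fun k => by
      rw [ENNReal.ofReal_mul (by positivity), ENNReal.ofReal_toReal hD]
      exact H B x z _ hB hBq hBK hz hx k) hn
  calc _ ≤ (1 + condNumber L) * ‖x - extendZero n fun k => x k‖ :=
        h.norm_sub_sectionSolution_le hT hxy n
    _ ≤ (1 + κ) * (√2 * (D.toReal * (‖opInv L‖ * c')) * (n : ℝ) ^ ((1 - 2 * s) / 2)) := by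
        have := h.one_le_condNumber
        gcongr
        linarith
    _ = _ := by ring

/-- The rate `γ₁` is at our disposal, and estimates with a given rate persist for all smaller
rates; taking `γ₁` below the reciprocal of the constant in the decay estimate of the solution
turns this constant into `1 / γ₁`. The factor `1 + κ` is the quasi-optimality constant. -/
theorem exists_exponential_bound {γ : ℝ} (hγ : 0 < γ) (κ R : ℝ) :
    ∃ γ₁ : ℝ, 0 < γ₁ ∧ γ₁ < γ ∧
      ∀ (L : SeqSpace →L[ℂ] SeqSpace) (a : ℤ → ℂ) (x y : SeqSpace) (c c' : ℝ),
        IsToeplitz L a → IsHPD L → L x = y →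
        condNumber L ≤ κ → c ≤ R * ‖L‖ →
        (∀ k : ℤ, ‖a k‖ ≤ c * Real.exp (-γ * |(k : ℝ)|)) →
        (∀ k : ℤ, ‖y k‖ ≤ c' * Real.exp (-γ * |(k : ℝ)|)) →
        ∀ n : ℕ, 1 ≤ n →
          ‖x - sectionSolution a y n‖
            ≤ (1 + κ) / γ₁ * (‖opInv L‖ * c') * Real.exp (-γ₁ * (n : ℝ)) := by
  set S := ∑' k : ℤ, ENNReal.ofReal (Real.exp (-(γ / 2) * |(k : ℝ)|)) with hS
  have hStop : S ≠ ⊤ := tsum_exponential_weight_ne_top (by positivity)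
  have hmul : ∀ k : ℤ, ENNReal.ofReal (Real.exp (-γ * |(k : ℝ)|))
      * ENNReal.ofReal (Real.exp (γ / 2 * |(k : ℝ)|))
      = ENNReal.ofReal (Real.exp (-(γ / 2) * |(k : ℝ)|)) := fun k => by
    rw [← ENNReal.ofReal_mul (by positivity), ← Real.exp_add]
    congr 2
    ring
  obtain ⟨η, D, hη0, hη1, hD, H⟩ := exists_weightedSum_bound
    (w := fun η k => ENNReal.ofReal (Real.exp (η * (γ / 2) * |(k : ℝ)|)))
    (w₁ := fun k => ENNReal.ofReal (Real.exp (γ / 2 * |(k : ℝ)|)))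
    (fun η k => ENNReal.ofReal_ne_top)
    (fun η hη => exponential_weight_add_le (by positivity))
    (exponential_weight_add_le (by positivity)) (by simp)
    (fun η h0 h1 k => by
      rw [← ENNReal.ofReal_mul h0.le, ← ENNReal.ofReal_one, ← ENNReal.ofReal_add (by simp)
        (by positivity), mul_assoc]
      exact ENNReal.ofReal_le_ofReal (exp_mul_le_one_add h0.le h1 _))
    (fun η h0 h1 k => by
      refine ENNReal.ofReal_le_ofReal (Real.exp_le_exp.2 ?_)
      rw [mul_assoc]
      exact mul_le_of_le_one_left (by positivity) h1)
    (g := fun k => ENNReal.ofReal (1 + max R 0) * ENNReal.ofReal (Real.exp (-γ * |(k : ℝ)|)))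
    (by
      rw [ENNReal.tsum_mul_left]
      exact ENNReal.mul_ne_top ENNReal.ofReal_ne_top (tsum_exponential_weight_ne_top hγ))
    (by
      simp only [mul_assoc, hmul, ENNReal.tsum_mul_left]
      exact ENNReal.mul_ne_top ENNReal.ofReal_ne_top hStop)
    (Real.sqrt_nonneg _) (sqrt_one_sub_inv_sq_lt_one (lt_max_of_lt_right one_pos : 0 < max κ 1))
  set E : ℝ := (D * S).toReal with hE
  have hE0 : 0 ≤ E := ENNReal.toReal_nonneg
  have hDS : D * S ≠ ⊤ := ENNReal.mul_ne_top hD hStop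
  set γ₁ := min (η * (γ / 2)) (E + 1)⁻¹ with hγ₁
  have hγ₁0 : 0 < γ₁ := lt_min (by positivity) (by positivity)
  refine ⟨γ₁, hγ₁0, (min_le_left _ _).trans_lt (by nlinarith),
    fun L a x y c c' hT h hxy hκ hc ha hy n hn => ?_⟩
  obtain ⟨B, z, hB, hBq, hBK, hz, hx⟩ := h.exists_contraction hT hxy
    (hκ.trans (le_max_left κ 1)) hc (fun k => by positivity) (by simp) ha hy
  have hc'0 : 0 ≤ c' := by simpa using (norm_nonneg _).trans (hy 0)
  have hz1 : weightedSum (fun k => ENNReal.ofReal (Real.exp (γ / 2 * |(k : ℝ)|))) z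
      ≤ ENNReal.ofReal (‖opInv L‖ * c') * S := by
    rw [hS, ← ENNReal.tsum_mul_left]
    refine ENNReal.tsum_le_tsum fun k => ?_
    rw [← hmul, ← mul_assoc]
    gcongr
    exact hz k
  have h1 := norm_sub_extendZero_le_of_weightedSum (r := η * (γ / 2)) (by positivity)
    (D := E * (‖opInv L‖ * c')) (x := x) (by positivity) (by
      refine (H B x z _ hB hBq hBK hz1 hx).trans_eq ?_
      rw [ENNReal.ofReal_mul hE0, hE, ENNReal.ofReal_toReal hDS]
      ring) n
  have hEγ : E ≤ 1 / γ₁ := by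
    rw [le_div_iff₀ hγ₁0]
    calc E * γ₁ ≤ (E + 1) * (E + 1)⁻¹ := by
          gcongr
          · linarith
          · exact min_le_right _ _
      _ = 1 := mul_inv_cancel₀ (by positivity)
  have hκ1 := h.one_le_condNumber
  calc _ ≤ (1 + condNumber L) * ‖x - extendZero n fun k => x k‖ :=
        h.norm_sub_sectionSolution_le hT hxy n
    _ ≤ (1 + κ) * (1 / γ₁ * (‖opInv L‖ * c') * Real.exp (-γ₁ * n)) := by
        refine mul_le_mul (by linarith) (h1.trans ?_) (norm_nonneg _) (by linarith)
        gcongr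
        exact min_le_left _ _
    _ = _ := by ring

/-! ### Convergence rates of the finite section method -/

theorem mainTheorem1 :
    -- the objects are well defined: `L` and all its finite sections are invertible
    (∀ (L : SeqSpace →L[ℂ] SeqSpace) (a : ℤ → ℂ), IsToeplitz L a → IsHPD L →
      IsUnit L ∧ ∀ n : ℕ, 1 ≤ n → IsUnit (finiteSection a n)) ∧
    -- (a) exponential decay
    (∃ C₁ : ℝ → ℝ → ℝ, ∀ γ : ℝ, 0 < γ → ∀ κ R : ℝ, ∃ γ₁ : ℝ, 0 < γ₁ ∧ γ₁ < γ ∧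
      ∀ (L : SeqSpace →L[ℂ] SeqSpace) (a : ℤ → ℂ) (x y : SeqSpace) (c c' : ℝ),
        IsToeplitz L a → IsHPD L → L x = y →
        condNumber L ≤ κ → c ≤ R * ‖L‖ →
        (∀ k : ℤ, ‖a k‖ ≤ c * Real.exp (-γ * |(k : ℝ)|)) →
        (∀ k : ℤ, ‖y k‖ ≤ c' * Real.exp (-γ * |(k : ℝ)|)) →
        ∀ n : ℕ, 1 ≤ n →
          ‖x - sectionSolution a y n‖
            ≤ C₁ γ₁ κ * (‖opInv L‖ * c') * Real.exp (-γ₁ * (n : ℝ))) ∧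
    -- (b) polynomial decay
    (∀ s : ℝ, 1 < s → ∀ κ R : ℝ, ∃ c₁ : ℝ,
      ∀ (L : SeqSpace →L[ℂ] SeqSpace) (a : ℤ → ℂ) (x y : SeqSpace) (c c' : ℝ),
        IsToeplitz L a → IsHPD L → L x = y →
        condNumber L ≤ κ → c ≤ R * ‖L‖ →
        (∀ k : ℤ, ‖a k‖ ≤ c * (1 + |(k : ℝ)|) ^ (-s)) →
        (∀ k : ℤ, ‖y k‖ ≤ c' * (1 + |(k : ℝ)|) ^ (-s)) →
        ∀ n : ℕ, 1 ≤ n →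
          ‖x - sectionSolution a y n‖
            ≤ c₁ * (‖opInv L‖ * c') * (n : ℝ) ^ ((1 - 2 * s) / 2)) := by
  exact ⟨fun _ _ hT h => ⟨h.isUnit, fun n _ => h.isUnit_finiteSection hT n⟩,
    ⟨fun γ₁ κ => (1 + κ) / γ₁, fun _ hγ κ R => exists_exponential_bound hγ κ R⟩,
    fun _ hs κ R => exists_polynomial_bound hs κ R⟩
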